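/- Let $K$ be a field and let $E=(E^0,E^1,s,r)$ be a finite directed graph ($s,r:E^1\to E^0$ arbitrary, $E^0,E^1$ finite). The path algebra $KE$ is the associative $K$-algebra generated by $E^0\cup E^1$ subject to $vw=\delta_{v,w}v$ for $v,w\in E^0$ and $s(e)e=e=e\,r(e)$ for $e\in E^1$ (its identity is $\sum_{v\in E^0}v$). Let $\widehat E$ be the graph obtained from $E$ by adding, for each $e\in E^1$, an edge $e^*$ from $r(e)$ to $s(e)$. The Cohn path algebra $C_K(E)$ is the quotient of $K\widehat E$ by the relations $e^*f=\delta_{e,f}\,r(e)$ for $e,f\in E^1$, and the Leavitt path algebra $L_K(E)$ is the quotient of $K\widehat E$ by these relations together with $\sum_{e\in s^{-1}(v)}ee^*=v$ for every $v\in E^0$ with $s^{-1}(v)\neq\emptyset$. A path $\mu=e_1\cdots e_m$ of length $\ell(\mu)=m\ge 1$ is a sequence of edges with $r(e_i)=s(e_{i+1})$ for $1\le i<m$, and $\mu^*=e_m^*\cdots e_1^*$; vertices $v$ are the paths of length $0$, and $v^*=v$. The standard filtration $\{V_n\}_{n\ge 0}$ of $KE$ is $V_n=\operatorname{span}\{\mu:\ell(\mu)\le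 n\}$; those of $C_K(E)$ and $L_K(E)$ are $V_n=\operatorname{span}\{\lambda\mu^*:\ \lambda,\mu \text{ paths of } E,\ \ell(\lambda)+\ell(\mu)\le n\}$. For an algebra $A$ with filtration $\{V_n\}$, the algebraic entropy is $h_{\rm alg}(A)=0$ if $\dim_K A<\infty$, and $h_{\rm alg}(A)=\limsup_{n\to\infty}\frac1n\log\dim_K(V_n/V_{n-1})$ otherwise. Then, with respect to the standard filtrations, $$h_{\rm alg}(C_K(E))\le h_{\rm alg}(KE),$$ and consequently $$h_{\rm alg}(KE)=h_{\rm alg}(L_K(E))=h_{\rm alg}(C_K(E)).$$ -/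

import Mathlib

/-- A directed graph `(E⁰, E¹, s, r)` with vertex set `V` and edge set `E`. -/
structure DirectedGraph (V E : Type*) where
  /-- the source map -/
  s : E → V
  /-- the range map -/
  r : E → V

namespace DirectedGraph

/-- A vertex is regular if it is neither a sink nor an infinite emitter. -/
def IsRegular {V E : Type*} (G : DirectedGraph V E) (v : V) : Prop :=
  {e : E | G.s e = v}.Nonempty ∧ {e : E | G.s e = v}.Finite

/-- The extended graph: `Sum.inl e` is the edge `e`, and `Sum.inr e` is the ghost edge `e*`,
which has the reverse orientation. -/
def extended {V E : Type*} (G : DirectedGraph V E) : DirectedGraph V (E ⊕ E) where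
  s := Sum.elim G.s G.r
  r := Sum.elim G.r G.s

/-- `G.IsPathFrom v [e₁, …, eₘ]` says that `s(e₁) = v` and `r(eᵢ) = s(eᵢ₊₁)` for all `i < m`. -/
def IsPathFrom {V E : Type*} (G : DirectedGraph V E) : V → List E → Prop
  | _, [] => True
  | v, e :: p => G.s e = v ∧ G.IsPathFrom (G.r e) p

/-- A path of the graph: a source vertex together with a composable list of edges starting there.
The path at `v` with empty list of edges is the vertex `v`, as a trivial path. -/
structure Path {V E : Type*} (G : DirectedGraph V E) where
  /-- the source of the path -/
  source : V
  /-- the edges of the path, in order -/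
  edges : List E
  isPath : G.IsPathFrom source edges

/-- The length of a path. -/
def Path.length {V E : Type*} {G : DirectedGraph V E} (p : G.Path) : ℕ := p.edges.length

/-! ### The path algebra -/

/-- The defining relations of the path algebra, on the free associative unital algebra on the
vertices and the edges. For a graph with finitely many vertices, the not necessarily unital algebra
presented by (V) and (E) has the identity element `∑ v`; the relation `unit` records that this
element is the `1` of the unital algebra constructed here. -/
inductive PathRel (K : Type*) [Field K] {V E : Type*} [Fintype V] (G : DirectedGraph V E) :
    FreeAlgebra K (V ⊕ E) → FreeAlgebra K (V ⊕ E) → Prop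
  | vertex_mul_self (v : V) :
      PathRel K G (FreeAlgebra.ι K (Sum.inl v) * FreeAlgebra.ι K (Sum.inl v))
        (FreeAlgebra.ι K (Sum.inl v))
  | vertex_mul_of_ne (v w : V) (h : v ≠ w) :
      PathRel K G (FreeAlgebra.ι K (Sum.inl v) * FreeAlgebra.ι K (Sum.inl w)) 0
  | source_mul (e : E) :
      PathRel K G (FreeAlgebra.ι K (Sum.inl (G.s e)) * FreeAlgebra.ι K (Sum.inr e))
        (FreeAlgebra.ι K (Sum.inr e))
  | mul_range (e : E) :
      PathRel K G (FreeAlgebra.ι K (Sum.inr e) * FreeAlgebra.ι K (Sum.inl (G.r e)))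
        (FreeAlgebra.ι K (Sum.inr e))
  | unit : PathRel K G (∑ v : V, FreeAlgebra.ι K (Sum.inl v)) 1

/-- The path algebra `KE`. -/
def PathAlgebra (K : Type*) [Field K] {V E : Type*} [Fintype V] (G : DirectedGraph V E) :
    Type _ :=
  RingQuot (PathRel K G)

noncomputable instance (K : Type*) [Field K] {V E : Type*} [Fintype V] (G : DirectedGraph V E) :
    Ring (PathAlgebra K G) :=
  inferInstanceAs (Ring (RingQuot (PathRel K G)))

noncomputable instance (K : Type*) [Field K] {V E : Type*} [Fintype V] (G : DirectedGraph V E) :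
    Algebra K (PathAlgebra K G) :=
  inferInstanceAs (Algebra K (RingQuot (PathRel K G)))

/-- The quotient map onto the path algebra. -/
noncomputable def paMk (K : Type*) [Field K] {V E : Type*} [Fintype V] (G : DirectedGraph V E) :
    FreeAlgebra K (V ⊕ E) →ₐ[K] PathAlgebra K G :=
  RingQuot.mkAlgHom K (PathRel K G)

/-- A vertex, as an element of the path algebra. -/
noncomputable def paVertex (K : Type*) [Field K] {V E : Type*} [Fintype V] (G : DirectedGraph V E) (v : V) :
    PathAlgebra K G :=
  paMk K G (FreeAlgebra.ι K (Sum.inl v))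

/-- An edge, as an element of the path algebra. -/
noncomputable def paEdge (K : Type*) [Field K] {V E : Type*} [Fintype V] (G : DirectedGraph V E) (e : E) :
    PathAlgebra K G :=
  paMk K G (FreeAlgebra.ι K (Sum.inr e))

/-- A path `e₁ ⋯ eₘ`, as an element of the path algebra: the product `s(e₁) e₁ ⋯ eₘ`, which
is the vertex itself for a trivial path. -/
noncomputable def paPath (K : Type*) [Field K] {V E : Type*} [Fintype V] (G : DirectedGraph V E) (p : G.Path) :
    PathAlgebra K G :=
  paVertex K G p.source * (p.edges.map (paEdge K G)).prod

/-- The standard filtration of the path algebra: the span of the paths of length at most `n`. -/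
noncomputable def paFiltration (K : Type*) [Field K] {V E : Type*} [Fintype V] (G : DirectedGraph V E) (n : ℕ) :
    Submodule K (PathAlgebra K G) :=
  Submodule.span K {x | ∃ p : G.Path, p.length ≤ n ∧ x = paPath K G p}

/-! ### Relative Cohn path algebras -/

open Classical in
/-- The relations (CK1), and (CK2) at the vertices of `X`, on the path algebra of the extended
graph. -/
inductive CohnRel (K : Type*) [Field K] {V E : Type*} [Fintype V] [Fintype E]
    (G : DirectedGraph V E) (X : Set V) :
    PathAlgebra K G.extended → PathAlgebra K G.extended → Prop
  | ghost_mul_self (e : E) :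
      CohnRel K G X (paEdge K G.extended (Sum.inr e) * paEdge K G.extended (Sum.inl e))
        (paVertex K G.extended (G.r e))
  | ghost_mul_of_ne (e f : E) (h : e ≠ f) :
      CohnRel K G X (paEdge K G.extended (Sum.inr e) * paEdge K G.extended (Sum.inl f)) 0
  | ck2 (v : V) (h : v ∈ X) :
      CohnRel K G X
        (∑ e : E with G.s e = v,
          paEdge K G.extended (Sum.inl e) * paEdge K G.extended (Sum.inr e))
        (paVertex K G.extended v)

/-- The Cohn path algebra `C_K^X(E)` of the graph relative to a set `X` of (regular) vertices. -/
def RelCohnAlgebra (K : Type*) [Field K] {V E : Type*} [Fintype V] [Fintype E]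
    (G : DirectedGraph V E) (X : Set V) : Type _ :=
  RingQuot (CohnRel K G X)

noncomputable instance (K : Type*) [Field K] {V E : Type*} [Fintype V] [Fintype E]
    (G : DirectedGraph V E) (X : Set V) : Ring (RelCohnAlgebra K G X) :=
  inferInstanceAs (Ring (RingQuot (CohnRel K G X)))

noncomputable instance (K : Type*) [Field K] {V E : Type*} [Fintype V] [Fintype E]
    (G : DirectedGraph V E) (X : Set V) : Algebra K (RelCohnAlgebra K G X) :=
  inferInstanceAs (Algebra K (RingQuot (CohnRel K G X)))

/-- The quotient map onto the relative Cohn path algebra. -/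
noncomputable def rcMk (K : Type*) [Field K] {V E : Type*} [Fintype V] [Fintype E]
    (G : DirectedGraph V E) (X : Set V) : PathAlgebra K G.extended →ₐ[K] RelCohnAlgebra K G X :=
  RingQuot.mkAlgHom K (CohnRel K G X)

/-- A vertex, as an element of the relative Cohn path algebra. -/
noncomputable def rcVertex (K : Type*) [Field K] {V E : Type*} [Fintype V] [Fintype E]
    (G : DirectedGraph V E) (X : Set V) (v : V) : RelCohnAlgebra K G X :=
  rcMk K G X (paVertex K G.extended v)

/-- A (real) edge, as an element of the relative Cohn path algebra. -/
noncomputable def rcEdge (K : Type*) [Field K] {V E : Type*} [Fintype V] [Fintype E]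
    (G : DirectedGraph V E) (X : Set V) (e : E) : RelCohnAlgebra K G X :=
  rcMk K G X (paEdge K G.extended (Sum.inl e))

/-- A ghost edge `e*`, as an element of the relative Cohn path algebra. -/
noncomputable def rcGhost (K : Type*) [Field K] {V E : Type*} [Fintype V] [Fintype E]
    (G : DirectedGraph V E) (X : Set V) (e : E) : RelCohnAlgebra K G X :=
  rcMk K G X (paEdge K G.extended (Sum.inr e))

/-- A path `e₁ ⋯ eₘ`, as an element of the relative Cohn path algebra. -/
noncomputable def rcPath (K : Type*) [Field K] {V E : Type*} [Fintype V] [Fintype E]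
    (G : DirectedGraph V E) (X : Set V) (p : G.Path) : RelCohnAlgebra K G X :=
  rcVertex K G X p.source * (p.edges.map (rcEdge K G X)).prod

/-- The ghost path `eₘ* ⋯ e₁*` of a path `e₁ ⋯ eₘ`; a vertex is its own ghost. -/
noncomputable def rcGhostPath (K : Type*) [Field K] {V E : Type*} [Fintype V] [Fintype E]
    (G : DirectedGraph V E) (X : Set V) (p : G.Path) : RelCohnAlgebra K G X :=
  (p.edges.reverse.map (rcGhost K G X)).prod * rcVertex K G X p.source

/-- The standard filtration of the relative Cohn path algebra: the span of the elements `λ μ*`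
where `λ` and `μ` are paths whose lengths add up to at most `n`. -/
noncomputable def rcFiltration (K : Type*) [Field K] {V E : Type*} [Fintype V] [Fintype E]
    (G : DirectedGraph V E) (X : Set V) (n : ℕ) : Submodule K (RelCohnAlgebra K G X) :=
  Submodule.span K {x | ∃ p q : G.Path, p.length + q.length ≤ n ∧
    x = rcPath K G X p * rcGhostPath K G X q}

/-- The Cohn path algebra `C_K(E)`: only (CK1) is imposed. -/
abbrev CohnAlgebra (K : Type*) [Field K] {V E : Type*} [Fintype V] [Fintype E]
    (G : DirectedGraph V E) : Type _ :=
  RelCohnAlgebra K G ∅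

/-- The Leavitt path algebra `L_K(E)`: (CK1) is imposed, and (CK2) at every regular vertex. -/
abbrev LeavittAlgebra (K : Type*) [Field K] {V E : Type*} [Fintype V] [Fintype E]
    (G : DirectedGraph V E) : Type _ :=
  RelCohnAlgebra K G {v | G.IsRegular v}

/-- The standard filtration of the Cohn path algebra. -/
noncomputable abbrev cohnFiltration (K : Type*) [Field K] {V E : Type*} [Fintype V] [Fintype E]
    (G : DirectedGraph V E) : ℕ → Submodule K (CohnAlgebra K G) :=
  rcFiltration K G ∅

/-- The standard filtration of the Leavitt path algebra. -/
noncomputable abbrev leavittFiltration (K : Type*) [Field K] {V E : Type*} [Fintype V] [Fintype E]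
    (G : DirectedGraph V E) : ℕ → Submodule K (LeavittAlgebra K G) :=
  rcFiltration K G {v | G.IsRegular v}

end DirectedGraph

/-- The dimension of `V_n / V_{n-1}`, as an extended natural number (the value at `n = 0` plays no
role in the entropy). -/
noncomputable def gradedDim (K : Type*) [Field K] {A : Type*} [Ring A] [Algebra K A]
    (F : ℕ → Submodule K A) (n : ℕ) : ℕ∞ :=
  Cardinal.toENat (Module.rank K (F n ⧸ (F (n - 1)).submoduleOf (F n)))

open Classical in
/-- The algebraic entropy of an algebra `A` filtered by the subspaces `F 0 ≤ F 1 ≤ ⋯`: zero if `A`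
is finite dimensional, and the upper limit of `log (dim (V_n / V_{n-1})) / n` otherwise.
The values are taken in the extended reals, with `log 0 = -∞` and `log ∞ = ∞`. -/
noncomputable def algEntropy (K : Type*) [Field K] {A : Type*} [Ring A] [Algebra K A]
    (F : ℕ → Submodule K A) : EReal :=
  if Module.Finite K A then 0
  else Filter.limsup (fun n : ℕ => ENNReal.log (gradedDim K F n : ENNReal) / (n : EReal))
    Filter.atTop

/-! Let p_n be the number of paths of length n. Everything reduces to p_n, uniformly for the Cohn
algebras relative to a set X of regular vertices; C_K(E) and L_K(E) are the two extreme choices of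
X.

Upper bound: V_n/V_{n-1} is spanned by the λμ* with ℓ(λ)+ℓ(μ) = n, so its dimension is at most the
convolution ∑ p_k p_{n-k} (`gradedDim_rcFiltration_le`). Convolving p with itself does not raise its
exponential rate, since p_n ≤ C e^{cn} gives ∑ p_k p_{n-k} ≤ (n+1) C² e^{cn}
(`limsup_log_le_of_le_convolution`).

Lower bound: for n ≥ 1 the paths of length n stay independent modulo V_{n-1}. The algebra acts on
the free module on V × ℕ × ℤ by a branching system: edges raise the ℤ-degree by 1 and ghost edges
lower it by 1. The degree n part of the image of a fixed degree 0 vector vanishes on V_{n-1},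
because λμ* has degree ℓ(λ)-ℓ(μ) < n there, and it sends the paths of length n to distinct basis
vectors (`linearIndependent_degreePart`). Pulled back to KE, this gives dimension exactly p_n
(`gradedDim_paFiltration`).

If some p_n = 0, there are finitely many paths and all the algebras are finite dimensional;
otherwise none is, and the two bounds give equal limits superior. -/

/-! ### Bounding the dimension of V_n/V_{n-1}. -/

section GradedDim

variable {K : Type*} [Field K] {A : Type*} [Ring A] [Algebra K A]

/-- V_n/V_{n-1} embeds in A/V_{n-1}, and its image lies in the span of the classes of the `a i`. -/
theorem gradedDim_le_card (F : ℕ → Submodule K A) (n : ℕ) {ι : Type*} [Finite ι] (a : ι → A)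
    (h : F n ≤ F (n - 1) ⊔ Submodule.span K (Set.range a)) :
    gradedDim K F n ≤ (Nat.card ι : ℕ∞) := by
  set b : ι → A ⧸ F (n - 1) := fun i => (F (n - 1)).mkQ (a i) with hb
  let g : (F n ⧸ (F (n - 1)).submoduleOf (F n)) →ₗ[K] A ⧸ F (n - 1) :=
    Submodule.mapQ _ _ (F n).subtype le_rfl
  have hg : Function.Injective g := by
    refine (injective_iff_map_eq_zero g).2 fun x hx => ?_
    obtain ⟨x, rfl⟩ := Submodule.Quotient.mk_surjective _ x
    exact (Submodule.Quotient.mk_eq_zero _).2 ((Submodule.Quotient.mk_eq_zero (F (n - 1))).1 hx)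
  have hr : LinearMap.range g ≤ Submodule.span K (Set.range b) := by
    rintro _ ⟨x, rfl⟩
    obtain ⟨x, rfl⟩ := Submodule.Quotient.mk_surjective _ x
    have hx : (F (n - 1)).mkQ (x : A) ∈
        (F (n - 1) ⊔ Submodule.span K (Set.range a)).map (F (n - 1)).mkQ :=
      Submodule.mem_map_of_mem (h x.2)
    rw [Submodule.map_sup, Submodule.mkQ_map_self, bot_sup_eq, Submodule.map_span,
      ← Set.range_comp] at hx
    exact hx
  have h1 : Module.rank K (F n ⧸ (F (n - 1)).submoduleOf (F n)) ≤
      Module.rank K (Submodule.span K (Set.range b)) := by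
    refine LinearMap.rank_le_of_injective (g.codRestrict _ fun x => hr ⟨x, rfl⟩) ?_
    exact fun x y hxy => hg (congrArg Subtype.val hxy)
  have h2 : Cardinal.toENat (Cardinal.mk (Set.range b)) ≤ (Nat.card ι : ℕ∞) := by
    have := Cardinal.toENat.monotone' (Cardinal.mk_range_le_lift (f := b))
    rw [← ENat.card_eq_coe_natCard]
    simpa [ENat.card] using this
  exact (Cardinal.toENat.monotone' (h1.trans (rank_span_le _))).trans h2

/-- Since `ψ` kills V_{n-1}, it descends to V_n/V_{n-1}, and independence of images forces
independence of classes. -/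
theorem card_le_gradedDim (F : ℕ → Submodule K A) (n : ℕ) {ι : Type*} [Finite ι] (a : ι → A)
    (ha : ∀ i, a i ∈ F n) {M : Type*} [AddCommGroup M] [Module K M] (ψ : A →ₗ[K] M)
    (hψ : F (n - 1) ≤ LinearMap.ker ψ) (hli : LinearIndependent K (fun i => ψ (a i))) :
    (Nat.card ι : ℕ∞) ≤ gradedDim K F n := by
  let g : (F n ⧸ (F (n - 1)).submoduleOf (F n)) →ₗ[K] M :=
    Submodule.liftQ _ (ψ ∘ₗ (F n).subtype) (fun x hx => hψ hx)
  have h : LinearIndependent K (fun i => g (Submodule.Quotient.mk ⟨a i, ha i⟩)) := hli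
  have h' := (LinearIndependent.of_comp g h).cardinal_lift_le_rank
  have h2 : Cardinal.toENat (Cardinal.lift (Cardinal.mk ι)) ≤ Cardinal.toENat
      (Cardinal.lift (Module.rank K (F n ⧸ (F (n - 1)).submoduleOf (F n)))) :=
    Cardinal.toENat.monotone' h'
  rw [Cardinal.toENat_lift, Cardinal.toENat_lift] at h2
  rw [← ENat.card_eq_coe_natCard]
  exact h2

/-- Nonzero quotients make the filtration strictly increasing, which a Noetherian module does not
allow. -/
theorem not_finite_of_gradedDim_pos (F : ℕ → Submodule K A) (hF : Monotone F)
    (h : ∀ n, 1 ≤ n → gradedDim K F n ≠ 0) : ¬ Module.Finite K A := by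
  intro _
  have hs : StrictMono F := by
    refine strictMono_nat_of_lt_succ fun n => lt_of_le_of_ne (hF n.le_succ) fun he => ?_
    apply h (n + 1) (by omega)
    have : Subsingleton (F (n + 1) ⧸ (F (n + 1 - 1)).submoduleOf (F (n + 1))) := by
      rw [Submodule.Quotient.subsingleton_iff, Submodule.submoduleOf_eq_top]
      exact he.ge
    rw [gradedDim, rank_subsingleton', map_zero]
  exact not_strictMono_of_wellFoundedGT F hs

end GradedDim

/-! ### Exponential growth rates and convolution. -/

section Growth

open Filter Topology

theorem exists_pos_mul_exp_bound {p : ℕ → ℕ} (c : ℝ)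
    (h : ∀ᶠ n in atTop, (p n : ℝ) ≤ Real.exp (c * n)) :
    ∃ C : ℝ, 1 ≤ C ∧ ∀ n, (p n : ℝ) ≤ C * Real.exp (c * n) := by
  obtain ⟨N, hN⟩ := eventually_atTop.1 h
  -- The sum absorbs the finitely many terms before the bound sets in; the 1 serves the tail.
  refine ⟨1 + ∑ k ∈ Finset.range N, (p k : ℝ) / Real.exp (c * k), ?_, fun n => ?_⟩
  · have : 0 ≤ ∑ k ∈ Finset.range N, (p k : ℝ) / Real.exp (c * k) :=
      Finset.sum_nonneg fun _ _ => by positivity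
    linarith
  · have h0 : 0 ≤ ∑ k ∈ Finset.range N, (p k : ℝ) / Real.exp (c * k) :=
      Finset.sum_nonneg fun _ _ => by positivity
    rcases lt_or_ge n N with hn | hn
    · have h1 : (p n : ℝ) / Real.exp (c * n) ≤
          ∑ k ∈ Finset.range N, (p k : ℝ) / Real.exp (c * k) :=
        Finset.single_le_sum (f := fun k : ℕ => (p k : ℝ) / Real.exp (c * k))
          (fun _ _ => by positivity) (Finset.mem_range.2 hn)
      rw [← div_le_iff₀ (Real.exp_pos _)]
      linarith
    · refine (hN n hn).trans (le_mul_of_one_le_left (Real.exp_pos _).le (by linarith))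

theorem ennreal_log_natCast {n : ℕ} (hn : 1 ≤ n) :
    ENNReal.log (n : ENNReal) = ((Real.log n : ℝ) : EReal) := by
  have h : (0 : ℝ) < n := by exact_mod_cast hn
  rw [← ENNReal.ofReal_natCast, ENNReal.log_ofReal_of_pos h]

theorem log_div_le_iff {n : ℕ} (hn : 1 ≤ n) {m : ℕ} (hm : 1 ≤ m) (c : ℝ) :
    ENNReal.log (m : ENNReal) / (n : EReal) ≤ c ↔ (m : ℝ) ≤ Real.exp (c * n) := by
  have h : (0 : ℝ) < n := by exact_mod_cast hn
  have hm' : (0 : ℝ) < m := by exact_mod_cast hm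
  rw [ennreal_log_natCast hm, show (n : EReal) = ((n : ℝ) : EReal) from rfl, ← EReal.coe_div,
    EReal.coe_le_coe_iff, div_le_iff₀ h, Real.log_le_iff_le_exp hm']

/-- A sequence dominated by the convolution square of `p` grows exponentially at most as fast
as `p`. -/
theorem limsup_log_le_of_le_convolution {p d : ℕ → ℕ} (hp : ∀ n, 1 ≤ p n)
    (hd : ∀ n, 1 ≤ n → 1 ≤ d n)
    (h : ∀ n, 1 ≤ n → d n ≤ ∑ k : Fin (n + 1), p k * p (n - k)) :
    limsup (fun n : ℕ => ENNReal.log (d n : ENNReal) / (n : EReal)) atTop ≤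
      limsup (fun n : ℕ => ENNReal.log (p n : ENNReal) / (n : EReal)) atTop := by
  refine le_of_forall_gt_imp_ge_of_dense fun b hb => ?_
  -- Two intermediate rates: p is bounded at rate c, and the gap c' - c pays for the polynomial
  -- factor (n+1)C².
  obtain ⟨c, hc, hcb⟩ := EReal.lt_iff_exists_real_btwn.1 hb
  obtain ⟨c', hc', hcb'⟩ := EReal.lt_iff_exists_real_btwn.1 hcb
  have hcc : c < c' := by exact_mod_cast hc'
  refine le_trans ?_ hcb'.le
  have h1 : ∀ᶠ n in atTop, (p n : ℝ) ≤ Real.exp (c * n) := by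
    filter_upwards [eventually_lt_of_limsup_lt hc, eventually_ge_atTop 1] with n hn h1
    exact (log_div_le_iff h1 (hp n) c).1 hn.le
  obtain ⟨C, hC, hb⟩ := exists_pos_mul_exp_bound c h1
  have h2 : ∀ᶠ n : ℕ in atTop, ((n : ℝ) + 1) * C ^ 2 ≤ Real.exp ((c' - c) * n) := by
    have t1 : Tendsto (fun n : ℕ => (c' - c) * (n : ℝ)) atTop atTop :=
      tendsto_natCast_atTop_atTop.const_mul_atTop (sub_pos.2 hcc)
    have t2 := (Real.tendsto_exp_div_pow_atTop 1).comp t1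
    -- The threshold is chosen so that the exponential is at least 2C²n, which dominates (n+1)C²
    -- once n ≥ 1.
    filter_upwards [t2.eventually_ge_atTop (2 * C ^ 2 / (c' - c)), eventually_ge_atTop 1]
      with n hn h1
    have hn0 : (1 : ℝ) ≤ n := by exact_mod_cast h1
    have hpos : 0 < (c' - c) * (n : ℝ) := mul_pos (sub_pos.2 hcc) (by linarith)
    simp only [Function.comp, pow_one] at hn
    rw [le_div_iff₀ hpos] at hn
    have : 2 * C ^ 2 / (c' - c) * ((c' - c) * n) = 2 * C ^ 2 * n := by
      field_simp [(sub_pos.2 hcc).ne']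
    rw [this] at hn
    nlinarith [sq_nonneg C]
  refine limsup_le_of_le (by isBoundedDefault) ?_
  filter_upwards [h2, eventually_ge_atTop 1] with n hn h1
  refine (log_div_le_iff h1 (hd n h1) c').2 ?_
  calc (d n : ℝ) ≤ ∑ k : Fin (n + 1), (p k : ℝ) * p (n - k) := by exact_mod_cast h n h1
    _ ≤ ∑ k : Fin (n + 1), C ^ 2 * Real.exp (c * n) := by
        refine Finset.sum_le_sum fun k _ => ?_
        have hk : ((n - (k : ℕ) : ℕ) : ℝ) = n - (k : ℕ) := Nat.cast_sub (by omega)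
        calc (p k : ℝ) * p (n - k)
            ≤ (C * Real.exp (c * (k : ℕ))) * (C * Real.exp (c * (n - (k : ℕ) : ℕ))) :=
              mul_le_mul (hb _) (hb _) (by positivity) (by positivity)
          _ = C ^ 2 * (Real.exp (c * (k : ℕ)) * Real.exp (c * (n - (k : ℕ) : ℕ))) := by ring
          _ = C ^ 2 * Real.exp (c * n) := by rw [← Real.exp_add, hk]; ring_nf
    _ = ((n : ℝ) + 1) * C ^ 2 * Real.exp (c * n) := by simp; ring
    _ ≤ Real.exp ((c' - c) * n) * Real.exp (c * n) := by gcongr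
    _ = Real.exp (c' * n) := by rw [← Real.exp_add]; ring_nf

end Growth

namespace DirectedGraph

/-! ### Universal properties and the map from KE to the relative Cohn algebras. -/

section Lift

variable {K : Type*} [Field K] {V E : Type*} [Fintype V] {G : DirectedGraph V E}
  {B : Type*} [Semiring B] [Algebra K B]

/-- The universal property of the path algebra. -/
noncomputable def paLift (P : V → B) (T : E → B) (hPP : ∀ v, P v * P v = P v)
    (hPQ : ∀ v w, v ≠ w → P v * P w = 0) (hPT : ∀ e, P (G.s e) * T e = T e)
    (hTP : ∀ e, T e * P (G.r e) = T e) (hone : ∑ v, P v = 1) : PathAlgebra K G →ₐ[K] B :=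
  RingQuot.liftAlgHom K (s := PathRel K G) ⟨FreeAlgebra.lift K (Sum.elim P T), by
    intro x y h
    induction h with
    | vertex_mul_self v => simpa using hPP v
    | vertex_mul_of_ne v w h => simpa using hPQ v w h
    | source_mul e => simpa using hPT e
    | mul_range e => simpa using hTP e
    | unit => simpa using hone⟩

section

variable (P : V → B) (T : E → B) (hPP : ∀ v, P v * P v = P v)
    (hPQ : ∀ v w, v ≠ w → P v * P w = 0) (hPT : ∀ e, P (G.s e) * T e = T e)
    (hTP : ∀ e, T e * P (G.r e) = T e) (hone : ∑ v, P v = 1)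

@[simp]
theorem paLift_vertex (v : V) :
    paLift (K := K) P T hPP hPQ hPT hTP hone (paVertex K G v) = P v :=
  (RingQuot.liftAlgHom_mkAlgHom_apply K _ _ _).trans (by simp)

@[simp]
theorem paLift_edge (e : E) :
    paLift (K := K) P T hPP hPQ hPT hTP hone (paEdge K G e) = T e :=
  (RingQuot.liftAlgHom_mkAlgHom_apply K _ _ _).trans (by simp)

end

theorem paMk_eq_of_rel {x y : FreeAlgebra K (V ⊕ E)} (h : PathRel K G x y) :
    paMk K G x = paMk K G y :=
  RingQuot.mkAlgHom_rel K h

theorem paMk_surjective : Function.Surjective (paMk K G) :=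
  RingQuot.mkAlgHom_surjective K _

variable (K G)

@[simp]
theorem paVertex_mul_self (v : V) : paVertex K G v * paVertex K G v = paVertex K G v := by
  simpa only [map_mul] using! paMk_eq_of_rel (PathRel.vertex_mul_self (K := K) (G := G) v)

theorem paVertex_mul_of_ne {v w : V} (h : v ≠ w) : paVertex K G v * paVertex K G w = 0 := by
  simpa only [map_mul, map_zero] using!
    paMk_eq_of_rel (PathRel.vertex_mul_of_ne (K := K) (G := G) v w h)

@[simp]
theorem paVertex_source_mul (e : E) : paVertex K G (G.s e) * paEdge K G e = paEdge K G e := by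
  simpa only [map_mul] using! paMk_eq_of_rel (PathRel.source_mul (K := K) (G := G) e)

@[simp]
theorem paEdge_mul_range (e : E) : paEdge K G e * paVertex K G (G.r e) = paEdge K G e := by
  simpa only [map_mul] using! paMk_eq_of_rel (PathRel.mul_range (K := K) (G := G) e)

theorem sum_paVertex : ∑ v, paVertex K G v = 1 := by
  simpa only [map_sum, map_one] using! paMk_eq_of_rel (PathRel.unit (K := K) (G := G))

/-- The inclusion of the path algebra in the path algebra of the extended graph. -/
noncomputable def paToExtended : PathAlgebra K G →ₐ[K] PathAlgebra K G.extended :=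
  paLift (paVertex K G.extended) (fun e => paEdge K G.extended (Sum.inl e))
    (paVertex_mul_self K G.extended) (fun _ _ h => paVertex_mul_of_ne K G.extended h)
    (fun e => paVertex_source_mul K G.extended (Sum.inl e))
    (fun e => paEdge_mul_range K G.extended (Sum.inl e)) (sum_paVertex K G.extended)

variable [Fintype E] (X : Set V)

/-- The canonical map of the path algebra to a relative Cohn path algebra. -/
noncomputable def paToRc : PathAlgebra K G →ₐ[K] RelCohnAlgebra K G X :=
  (rcMk K G X).comp (paToExtended K G)

@[simp]
theorem paToRc_vertex (v : V) : paToRc K G X (paVertex K G v) = rcVertex K G X v :=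
  congrArg (rcMk K G X) (paLift_vertex ..)

@[simp]
theorem paToRc_edge (e : E) : paToRc K G X (paEdge K G e) = rcEdge K G X e :=
  congrArg (rcMk K G X) (paLift_edge ..)

theorem paToRc_path (p : G.Path) : paToRc K G X (paPath K G p) = rcPath K G X p := by
  simp only [paPath, rcPath, map_mul, map_list_prod, List.map_map, paToRc_vertex]
  congr 3
  funext e
  exact paToRc_edge K G X e

variable {K G X}

/-- The universal property of the relative Cohn path algebra, over the path algebra of the
extended graph. -/
noncomputable def rcLift (f : PathAlgebra K G.extended →ₐ[K] B)
    (h : ∀ ⦃x y⦄, CohnRel K G X x y → f x = f y) : RelCohnAlgebra K G X →ₐ[K] B :=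
  RingQuot.liftAlgHom K (s := CohnRel K G X) ⟨f, h⟩

@[simp]
theorem rcLift_mk (f : PathAlgebra K G.extended →ₐ[K] B)
    (h : ∀ ⦃x y⦄, CohnRel K G X x y → f x = f y) (x : PathAlgebra K G.extended) :
    rcLift f h (rcMk K G X x) = f x :=
  RingQuot.liftAlgHom_mkAlgHom_apply K f h x

end Lift

/-! ### Operators induced by partial self-maps of a basis. -/

section PartialOp

variable (K : Type*) [Field K] {Ω : Type*}

/-- The linear operator on the free module on `Ω` induced by a partial self-map of `Ω`. -/
noncomputable def partialOp (f : Ω → Option Ω) : Module.End K (Ω →₀ K) :=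
  Finsupp.linearCombination K fun x => (f x).elim 0 fun y => Finsupp.single y 1

theorem partialOp_single (f : Ω → Option Ω) (x : Ω) :
    partialOp K f (Finsupp.single x 1) = (f x).elim 0 fun y => Finsupp.single y 1 := by
  simp [partialOp]

theorem partialOp_mul (f g : Ω → Option Ω) :
    partialOp K f * partialOp K g = partialOp K fun x => (g x).bind f := by
  refine Finsupp.lhom_ext' fun x => LinearMap.ext_ring ?_
  simp only [LinearMap.comp_apply, Finsupp.lsingle_apply, Module.End.mul_apply, partialOp_single]
  cases g x <;> simp [partialOp_single]

theorem partialOp_none : partialOp K (fun _ : Ω => none) = 0 := by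
  refine Finsupp.lhom_ext' fun x => LinearMap.ext_ring ?_
  simp [partialOp_single]

end PartialOp

/-! ### A branching system on V × ℕ × ℤ. -/

section Branching

variable {V E : Type*} [Finite E] (G : DirectedGraph V E)

/-- If v emits an edge, (edges at v) × ℕ is countably infinite, hence in bijection with ℕ.
Injectivity will give (CK1) and surjectivity (CK2). At a sink there are no edges to constrain. -/
theorem exists_branching : ∃ σ : E → ℕ → ℕ,
    (∀ e f k l, G.s e = G.s f → σ e k = σ f l → e = f ∧ k = l) ∧
    ∀ v, (∃ e, G.s e = v) → ∀ m, ∃ e k, G.s e = v ∧ σ e k = m := by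
  have key : ∀ v, ∃ τ : {e // G.s e = v} × ℕ → ℕ, Function.Injective τ ∧
      ((∃ e, G.s e = v) → Function.Surjective τ) := by
    intro v
    by_cases h : ∃ e, G.s e = v
    · have : Nonempty {e // G.s e = v} := ⟨⟨h.choose, h.choose_spec⟩⟩
      obtain ⟨τ⟩ := nonempty_equiv_of_countable (α := {e // G.s e = v} × ℕ) (β := ℕ)
      exact ⟨τ, τ.injective, fun _ => τ.surjective⟩
    · exact ⟨fun x => x.2, fun x => absurd ⟨x.1.1, x.1.2⟩ h, fun h' => absurd h' h⟩
  choose τ hinj hsurj using key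
  refine ⟨fun e k => τ (G.s e) (⟨e, rfl⟩, k), fun e f k l h heq => ?_, fun v hv m => ?_⟩
  -- The vertex is kept variable so that both edges can be placed in the same fibre type.
  · have : ∀ v (h1 : G.s e = v) (h2 : G.s f = v),
        τ v (⟨e, h1⟩, k) = τ v (⟨f, h2⟩, l) → e = f ∧ k = l := by
      intro v h1 h2 h
      have := hinj v h
      simpa using this
    refine this (G.s f) h rfl (Eq.trans ?_ heq)
    generalize G.s f = v at h
    subst h
    rfl
  · obtain ⟨⟨⟨e, rfl⟩, k⟩, hk⟩ := hsurj v hv m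
    exact ⟨e, k, rfl, hk⟩

/-- An injection of `E × ℕ` over the source map, filling up `ℕ` over the vertices that are
not sinks. -/
noncomputable def branch (e : E) (k : ℕ) : ℕ := G.exists_branching.choose e k

theorem branch_inj {e f : E} {k l : ℕ} (h : G.s e = G.s f) (h' : G.branch e k = G.branch f l) :
    e = f ∧ k = l :=
  G.exists_branching.choose_spec.1 e f k l h h'

theorem branch_injective (e : E) : Function.Injective (G.branch e) :=
  fun _ _ h => (G.branch_inj rfl h).2

theorem exists_branch_eq {v : V} (h : ∃ e, G.s e = v) (m : ℕ) :
    ∃ e k, G.s e = v ∧ G.branch e k = m :=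
  G.exists_branching.choose_spec.2 v h m

open Classical in
/-- The partial identity at a vertex. -/
noncomputable def vertexMap (v : V) : V × ℕ × ℤ → Option (V × ℕ × ℤ) :=
  fun x => if x.1 = v then some x else none

open Classical in
/-- The action of an edge. -/
noncomputable def edgeMap (e : E) : V × ℕ × ℤ → Option (V × ℕ × ℤ) :=
  fun x => if x.1 = G.r e then some (G.s e, G.branch e x.2.1, x.2.2 + 1) else none

open Classical in
/-- The action of a ghost edge. -/
noncomputable def ghostMap (e : E) : V × ℕ × ℤ → Option (V × ℕ × ℤ) :=
  fun x => if x.1 = G.s e then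
    (Function.partialInv (G.branch e) x.2.1).map fun k => (G.r e, k, x.2.2 - 1) else none

end Branching

/-! ### The representation of the relative Cohn algebras. -/

section Representation

variable (K : Type*) [Field K] {V E : Type*} [Fintype E] (G : DirectedGraph V E)

theorem ghostOp_mul_edgeOp_self (e : E) :
    partialOp K (G.ghostMap e) * partialOp K (G.edgeMap e) = partialOp K (vertexMap (G.r e)) := by
  rw [partialOp_mul]
  congr 1
  funext x
  by_cases h : x.1 = G.r e
  · simp [vertexMap, edgeMap, ghostMap, h, Function.partialInv_left (G.branch_injective e)]
    exact Prod.ext h.symm rfl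
  · simp [vertexMap, edgeMap, h]

/-- Distinct edges with a common source have disjoint branch images; with different sources the
vertex coordinates already disagree. -/
theorem ghostOp_mul_edgeOp_of_ne {e f : E} (hef : e ≠ f) :
    partialOp K (G.ghostMap e) * partialOp K (G.edgeMap f) = 0 := by
  rw [partialOp_mul, ← partialOp_none]
  congr 1
  funext x
  by_cases h : x.1 = G.r f
  · by_cases h' : G.s f = G.s e
    · have hn : Function.partialInv (G.branch e) (G.branch f x.2.1) = none := by
        rw [Option.eq_none_iff_forall_ne_some]
        intro k hk
        exact hef (G.branch_inj h'.symm (((G.branch_injective e).isPartialInv k _).1 hk)).1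
      simp [edgeMap, ghostMap, h, h', hn]
    · simp [edgeMap, ghostMap, h, h']
  · simp [edgeMap, h]

-- Over a vertex that is not a sink, each m has the form `G.branch e k` for exactly one edge e, so a
-- single summand fixes each basis vector at v.
open Classical in
theorem sum_edgeOp_mul_ghostOp {v : V} (hv : ∃ e, G.s e = v) :
    ∑ e : E with G.s e = v, partialOp K (G.edgeMap e) * partialOp K (G.ghostMap e) =
      partialOp K (vertexMap v) := by
  refine Finsupp.lhom_ext' fun x => LinearMap.ext_ring ?_
  obtain ⟨w, m, d⟩ := x
  simp only [LinearMap.comp_apply, Finsupp.lsingle_apply, LinearMap.sum_apply, partialOp_mul,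
    partialOp_single]
  by_cases hw : w = v
  · subst hw
    obtain ⟨e, k, rfl, rfl⟩ := G.exists_branch_eq hv m
    rw [Finset.sum_eq_single e]
    · simp [ghostMap, edgeMap, vertexMap, Function.partialInv_left (G.branch_injective e)]
    · intro f hf hfe
      have hs : G.s f = G.s e := (Finset.mem_filter.1 hf).2
      have hn : Function.partialInv (G.branch f) (G.branch e k) = none := by
        rw [Option.eq_none_iff_forall_ne_some]
        intro l hl
        exact hfe (G.branch_inj hs (((G.branch_injective f).isPartialInv l _).1 hl)).1
      simp [ghostMap, hs, hn]
    · simp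
  · rw [Finset.sum_eq_zero]
    · simp [vertexMap, hw]
    · intro e he
      have hs : G.s e = v := (Finset.mem_filter.1 he).2
      simp [ghostMap, hs, hw]

variable [Fintype V]

open Classical in
theorem sum_vertexOp : ∑ v : V, partialOp K (vertexMap v) = 1 := by
  refine Finsupp.lhom_ext' fun x => LinearMap.ext_ring ?_
  simp only [LinearMap.comp_apply, Finsupp.lsingle_apply, LinearMap.sum_apply, partialOp_single]
  rw [Finset.sum_eq_single x.1] <;> simp +contextual [vertexMap, eq_comm]

/-- The representation of the path algebra of the extended graph. -/
noncomputable def extRep : PathAlgebra K G.extended →ₐ[K] Module.End K (V × ℕ × ℤ →₀ K) :=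
  paLift (fun v => partialOp K (vertexMap v))
    (Sum.elim (fun e => partialOp K (G.edgeMap e)) (fun e => partialOp K (G.ghostMap e)))
    (fun v => by
      rw [partialOp_mul]; congr 1; funext x; by_cases h : x.1 = v <;> simp [vertexMap, h])
    (fun v w hvw => by
      rw [partialOp_mul, ← partialOp_none]; congr 1; funext x
      by_cases h : x.1 = w <;> simp [vertexMap, h, hvw.symm])
    (by
      rintro (e | e)
      · simp only [Sum.elim_inl, extended]
        rw [partialOp_mul]; congr 1; funext x
        by_cases h : x.1 = G.r e <;> simp [vertexMap, edgeMap, h]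
      · simp only [Sum.elim_inr, extended]
        rw [partialOp_mul]; congr 1; funext x
        by_cases h : x.1 = G.s e <;> simp [vertexMap, ghostMap, h]
        cases Function.partialInv (G.branch e) x.2.1 <;> simp [vertexMap])
    (by
      rintro (e | e)
      · simp only [Sum.elim_inl, extended]
        rw [partialOp_mul]; congr 1; funext x
        by_cases h : x.1 = G.r e <;> simp [vertexMap, edgeMap, h]
      · simp only [Sum.elim_inr, extended]
        rw [partialOp_mul]; congr 1; funext x
        by_cases h : x.1 = G.s e <;> simp [vertexMap, ghostMap, h])
    (sum_vertexOp K)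

@[simp]
theorem extRep_vertex (v : V) :
    extRep K G (paVertex K G.extended v) = partialOp K (vertexMap v) :=
  paLift_vertex ..

@[simp]
theorem extRep_edge (e : E) :
    extRep K G (paEdge K G.extended (Sum.inl e)) = partialOp K (G.edgeMap e) :=
  paLift_edge ..

@[simp]
theorem extRep_ghost (e : E) :
    extRep K G (paEdge K G.extended (Sum.inr e)) = partialOp K (G.ghostMap e) :=
  paLift_edge ..

/-- The representation of a relative Cohn path algebra. -/
noncomputable def rcRep {X : Set V} (hX : ∀ v ∈ X, G.IsRegular v) :
    RelCohnAlgebra K G X →ₐ[K] Module.End K (V × ℕ × ℤ →₀ K) :=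
  rcLift (B := Module.End K (V × ℕ × ℤ →₀ K)) (extRep K G) (by
    intro x y h
    induction h with
    | ghost_mul_self e => simpa using ghostOp_mul_edgeOp_self K G e
    | ghost_mul_of_ne e f h => simpa using ghostOp_mul_edgeOp_of_ne K G h
    | ck2 v h => simpa using sum_edgeOp_mul_ghostOp K G (hX v h).1)

variable {X : Set V} (hX : ∀ v ∈ X, G.IsRegular v)

@[simp]
theorem rcRep_vertex (v : V) : rcRep K G hX (rcVertex K G X v) = partialOp K (vertexMap v) := by
  simp [rcRep, rcVertex]

@[simp]
theorem rcRep_edge (e : E) : rcRep K G hX (rcEdge K G X e) = partialOp K (G.edgeMap e) := by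
  simp [rcRep, rcEdge]

@[simp]
theorem rcRep_ghost (e : E) : rcRep K G hX (rcGhost K G X e) = partialOp K (G.ghostMap e) := by
  simp [rcRep, rcGhost]

end Representation

end DirectedGraph

namespace DirectedGraph

/-! ### Counting paths. -/

section Paths

variable {V E : Type*} (G : DirectedGraph V E)

@[ext]
theorem Path.ext {G : DirectedGraph V E} {p q : G.Path} (h : p.source = q.source)
    (h' : p.edges = q.edges) : p = q := by
  cases p; cases q; cases h; cases h'; rfl

/-- The paths of length `n`. -/
abbrev PathOfLength (n : ℕ) : Type _ := {p : G.Path // p.length = n}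

/-- The number of paths of length `n`. -/
noncomputable def numPaths (n : ℕ) : ℕ := Nat.card (G.PathOfLength n)

instance [Finite V] [Finite E] (n : ℕ) : Finite (G.PathOfLength n) := by
  have : Finite {l : List E // l.length = n} := List.finite_length_eq E n
  refine Finite.of_injective (β := V × {l : List E // l.length = n})
    (fun p => (p.1.source, ⟨p.1.edges, p.2⟩)) fun p q h => ?_
  simp only [Prod.mk.injEq] at h
  exact Subtype.ext (Path.ext h.1 (congrArg Subtype.val h.2))

theorem IsPathFrom.take {G : DirectedGraph V E} {v : V} {l : List E} (h : G.IsPathFrom v l)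
    (n : ℕ) : G.IsPathFrom v (l.take n) := by
  induction l generalizing v n with
  | nil => simpa using h
  | cons e l ih =>
    cases n with
    | zero => trivial
    | succ n => exact ⟨h.1, ih h.2 n⟩

/-- A path of length at least n would have a prefix of length n. -/
theorem length_lt_of_numPaths_eq_zero [Finite V] [Finite E] {G : DirectedGraph V E} {n : ℕ}
    (h : G.numPaths n = 0) (p : G.Path) : p.length < n := by
  by_contra! hp
  have : IsEmpty (G.PathOfLength n) := Finite.card_eq_zero_iff.1 h
  exact this.false ⟨⟨p.source, p.edges.take n, p.isPath.take n⟩, by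
    simpa [Path.length] using hp⟩

theorem finite_path_of_numPaths_eq_zero [Finite V] [Finite E] {G : DirectedGraph V E} {n : ℕ}
    (h : G.numPaths n = 0) : Finite G.Path := by
  refine Finite.of_injective (β := Σ k : Fin n, G.PathOfLength k)
    (fun p => ⟨⟨p.length, length_lt_of_numPaths_eq_zero h p⟩, ⟨p, rfl⟩⟩) fun p q hpq => ?_
  simp only [Sigma.mk.injEq, Fin.mk.injEq] at hpq
  obtain ⟨h1, h2⟩ := hpq
  -- Generalizing the length turns the heterogeneous equality into an ordinary one.
  have : ∀ (m : ℕ) (hm : q.length = m), p.length = m →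
      HEq (⟨p, rfl⟩ : G.PathOfLength p.length) (⟨q, hm⟩ : G.PathOfLength m) → p = q := by
    rintro m hm rfl h
    exact congrArg Subtype.val (eq_of_heq h)
  exact this _ rfl h1 h2

/-- The last vertex of a path. -/
def pathRange (G : DirectedGraph V E) : V → List E → V
  | v, [] => v
  | _, e :: l => G.pathRange (G.r e) l

theorem isPathFrom_append_singleton {v : V} {l : List E} {e : E} (h : G.IsPathFrom v l)
    (he : G.pathRange v l = G.s e) : G.IsPathFrom v (l ++ [e]) := by
  induction l generalizing v with
  | nil => exact ⟨he.symm, trivial⟩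
  | cons f l ih => exact ⟨h.1, ih h.2 he⟩

end Paths

/-! ### Upper bounds for the graded dimensions. -/

section Filtration

variable (K : Type*) [Field K] {V E : Type*} [Fintype V] (G : DirectedGraph V E)

theorem paFiltration_mono : Monotone (G.paFiltration K) := fun _ _ h =>
  Submodule.span_mono fun _ ⟨p, hp, hx⟩ => ⟨p, hp.trans h, hx⟩

theorem gradedDim_paFiltration_le [Finite E] (n : ℕ) :
    gradedDim K (G.paFiltration K) n ≤ (G.numPaths n : ℕ∞) := by
  refine gradedDim_le_card _ n (fun p : G.PathOfLength n => paPath K G p.1) ?_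
  refine Submodule.span_le.2 ?_
  rintro _ ⟨p, hp, rfl⟩
  rcases hp.lt_or_eq with h | h
  · exact Submodule.mem_sup_left (Submodule.subset_span ⟨p, by omega, rfl⟩)
  · exact Submodule.mem_sup_right (Submodule.subset_span ⟨⟨p, h⟩, rfl⟩)

variable [Fintype E] (X : Set V)

theorem rcFiltration_mono : Monotone (G.rcFiltration K X) := fun _ _ h =>
  Submodule.span_mono fun _ ⟨p, q, hp, hx⟩ => ⟨p, q, hp.trans h, hx⟩

/-- The spanning family is indexed by all pairs (λ, μ) of total length n, sorted by k = ℓ(λ). Pairs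
with different ranges contribute 0 and relations may remain, which is harmless for an upper bound.
-/
theorem gradedDim_rcFiltration_le (n : ℕ) :
    gradedDim K (G.rcFiltration K X) n ≤
      ((∑ k : Fin (n + 1), G.numPaths k * G.numPaths (n - k) : ℕ) : ℕ∞) := by
  have h : Nat.card (Σ k : Fin (n + 1), G.PathOfLength k × G.PathOfLength (n - k)) =
      ∑ k : Fin (n + 1), G.numPaths k * G.numPaths (n - k) := by
    simp only [Nat.card_sigma, Nat.card_prod, numPaths]
  rw [← h]
  refine gradedDim_le_card _ n
    (fun x : Σ k : Fin (n + 1), G.PathOfLength k × G.PathOfLength (n - k) =>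
      rcPath K G X x.2.1.1 * rcGhostPath K G X x.2.2.1) ?_
  refine Submodule.span_le.2 ?_
  rintro _ ⟨p, q, hp, rfl⟩
  rcases hp.lt_or_eq with h | h
  · exact Submodule.mem_sup_left (Submodule.subset_span ⟨p, q, by omega, rfl⟩)
  · exact Submodule.mem_sup_right (Submodule.subset_span
      ⟨⟨⟨p.length, by omega⟩, ⟨p, rfl⟩, ⟨q, by simp only; omega⟩⟩, rfl⟩)

end Filtration

/-! ### The ℤ-grading of the representation. -/

section Degree

variable {K : Type*} [Field K] {V : Type*}

/-- `IsShift k T` says that the operator `T` is homogeneous of degree `k`. -/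
def IsShift (k : ℤ) (T : Module.End K (V × ℕ × ℤ →₀ K)) : Prop :=
  ∀ d : ℤ, ∀ x ∈ Finsupp.supported K K {x : V × ℕ × ℤ | x.2.2 = d},
    T x ∈ Finsupp.supported K K {x : V × ℕ × ℤ | x.2.2 = d + k}

theorem IsShift.mul {j k : ℤ} {S T : Module.End K (V × ℕ × ℤ →₀ K)} (hS : IsShift j S)
    (hT : IsShift k T) : IsShift (j + k) (S * T) := by
  intro d x hx
  have := hS _ _ (hT _ _ hx)
  rwa [add_assoc, add_comm k j] at this

theorem IsShift.one : IsShift 0 (1 : Module.End K (V × ℕ × ℤ →₀ K)) := by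
  intro d x hx
  simpa using hx

theorem IsShift.list_prod {α : Type*} {k : ℤ} {T : α → Module.End K (V × ℕ × ℤ →₀ K)}
    (hT : ∀ a, IsShift k (T a)) (l : List α) : IsShift (l.length * k) (l.map T).prod := by
  induction l with
  | nil => simpa using! IsShift.one
  | cons a l ih =>
    have := (hT a).mul ih
    rwa [show k + l.length * k = (a :: l).length * k by push_cast [List.length_cons]; ring] at this

theorem isShift_partialOp {k : ℤ} {f : V × ℕ × ℤ → Option (V × ℕ × ℤ)}
    (hf : ∀ x, ∀ y ∈ f x, y.2.2 = x.2.2 + k) : IsShift k (partialOp K f) := by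
  intro d
  change Finsupp.supported K K {x : V × ℕ × ℤ | x.2.2 = d} ≤
    (Finsupp.supported K K {x : V × ℕ × ℤ | x.2.2 = d + k}).comap (partialOp K f)
  rw [Finsupp.supported_eq_span_single, Submodule.span_le]
  rintro _ ⟨x, rfl, rfl⟩
  rw [SetLike.mem_coe, Submodule.mem_comap, partialOp_single]
  cases h : f x with
  | none => exact Submodule.zero_mem _
  | some y => exact Finsupp.single_mem_supported K _ (hf x y h)

variable (K) {E : Type*} [Finite E] (G : DirectedGraph V E)

theorem isShift_vertex (v : V) : IsShift 0 (partialOp K (vertexMap v)) :=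
  isShift_partialOp fun x y h => by
    simp only [vertexMap] at h
    split_ifs at h <;> simp_all

theorem isShift_edge (e : E) : IsShift 1 (partialOp K (G.edgeMap e)) :=
  isShift_partialOp fun x y h => by
    simp only [edgeMap] at h
    split_ifs at h with h'
    · obtain rfl := Option.some.inj h
      rfl
    · cases h

theorem isShift_ghost (e : E) : IsShift (-1) (partialOp K (G.ghostMap e)) :=
  isShift_partialOp fun x y h => by
    simp only [ghostMap] at h
    split_ifs at h with h'
    · obtain ⟨k, -, rfl⟩ := Option.map_eq_some_iff.1 h
      rfl
    · cases h

end Degree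

/-! ### Independence of the paths of length n modulo V_{n-1}. -/

section Independence

variable (K : Type*) [Field K] {V E : Type*} [Fintype V] [Fintype E] (G : DirectedGraph V E)
  {X : Set V} (hX : ∀ v ∈ X, G.IsRegular v)

theorem isShift_rcPath (p : G.Path) : IsShift p.length (rcRep K G hX (rcPath K G X p)) := by
  have h := (isShift_vertex K p.source).mul (IsShift.list_prod (isShift_edge K G) p.edges)
  simpa [rcPath, map_list_prod, Function.comp_def, Path.length] using h

theorem isShift_rcGhostPath (p : G.Path) :
    IsShift (-p.length) (rcRep K G hX (rcGhostPath K G X p)) := by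
  have h := (IsShift.list_prod (isShift_ghost K G) p.edges.reverse).mul
    (isShift_vertex K p.source)
  simpa [rcGhostPath, map_list_prod, Function.comp_def, Path.length] using h

/-- The vector on which the paths act freely. -/
noncomputable def cyclicVector : V × ℕ × ℤ →₀ K := ∑ v : V, Finsupp.single (v, 0, 0) 1

theorem cyclicVector_mem :
    cyclicVector K ∈ Finsupp.supported K K {x : V × ℕ × ℤ | x.2.2 = 0} :=
  Submodule.sum_mem _ fun _ _ => Finsupp.single_mem_supported K _ rfl

/-- The second coordinate of the image of the cyclic vector under a path. -/
noncomputable def pathCode (l : List E) : ℕ := l.foldr G.branch 0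

theorem vertex_mul_edges_apply {v : V} {l : List E} (h : G.IsPathFrom v l) :
    (partialOp K (vertexMap v) * (l.map fun e => partialOp K (G.edgeMap e)).prod)
      (cyclicVector K) = Finsupp.single (v, G.pathCode l, (l.length : ℤ)) 1 := by
  classical
  induction l generalizing v with
  | nil =>
    simp only [List.map_nil, List.prod_nil, mul_one, cyclicVector, map_sum, partialOp_single]
    rw [Finset.sum_eq_single v] <;> simp +contextual [vertexMap, pathCode]
  | cons e l ih =>
    obtain ⟨rfl, hl⟩ := h
    -- Moving the vertex projection across e turns it into the projection at r(e), where the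
    -- remaining path starts, so the induction hypothesis applies.
    have he : partialOp K (vertexMap (G.s e)) * partialOp K (G.edgeMap e) =
        partialOp K (G.edgeMap e) * partialOp K (vertexMap (G.r e)) := by
      rw [partialOp_mul, partialOp_mul]
      congr 1
      funext x
      by_cases h : x.1 = G.r e <;> simp [vertexMap, edgeMap, h]
    rw [List.map_cons, List.prod_cons, ← mul_assoc, he, mul_assoc, Module.End.mul_apply, ih hl,
      partialOp_single]
    simp [edgeMap, pathCode]

theorem rcRep_path_apply (p : G.Path) :
    rcRep K G hX (rcPath K G X p) (cyclicVector K) =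
      Finsupp.single (p.source, G.pathCode p.edges, (p.length : ℤ)) 1 := by
  rw [Path.length, ← vertex_mul_edges_apply K G p.isPath]
  simp [rcPath, map_list_prod, Function.comp_def]

omit [Fintype V] in
-- The code is read off edge by edge: once the source is known, `branch_inj` recovers the first edge
-- and the code of the rest. Equal lengths are needed because 0, the code of the empty list, may
-- also be a branch value.
theorem pathCode_inj {v : V} {l l' : List E} (h : G.IsPathFrom v l) (h' : G.IsPathFrom v l')
    (hlen : l.length = l'.length) (hc : G.pathCode l = G.pathCode l') : l = l' := by
  induction l generalizing v l' with
  | nil => exact (List.length_eq_zero_iff.1 hlen.symm).symm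
  | cons e l ih =>
    cases l' with
    | nil => simp at hlen
    | cons f l' =>
      obtain ⟨rfl, h2⟩ := G.branch_inj (h.1.trans h'.1.symm) hc
      rw [ih h.2 h'.2 (by simpa using hlen) h2]

/-- The degree `n` part of the image of the cyclic vector. -/
noncomputable def degreePart (n : ℤ) :
    RelCohnAlgebra K G X →ₗ[K] ({x : V × ℕ × ℤ | x.2.2 = n} →₀ K) :=
  Finsupp.lsubtypeDomain _ ∘ₗ LinearMap.applyₗ (cyclicVector K) ∘ₗ (rcRep K G hX).toLinearMap

theorem degreePart_apply (n : ℤ) (a : RelCohnAlgebra K G X) (x : {x : V × ℕ × ℤ | x.2.2 = n}) :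
    degreePart K G hX n a x = rcRep K G hX a (cyclicVector K) x := rfl

theorem degreePart_eq_zero {k n : ℤ} (hkn : k ≠ n) {a : RelCohnAlgebra K G X}
    (ha : IsShift k (rcRep K G hX a)) : degreePart K G hX n a = 0 := by
  ext ⟨x, hx⟩
  have h := ha 0 _ (cyclicVector_mem K)
  rw [Finsupp.mem_supported'] at h
  rw [degreePart_apply]
  refine h x fun h' => hkn ?_
  simp only [Set.mem_ofPred_eq] at h' hx
  omega

/-- λμ* is homogeneous of degree ℓ(λ)-ℓ(μ) ≤ ℓ(λ)+ℓ(μ) ≤ n-1. The assumption n ≥ 1 excludes the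
truncated subtraction 0 - 1 = 0. -/
theorem rcFiltration_le_ker {n : ℕ} (hn : 1 ≤ n) :
    G.rcFiltration K X (n - 1) ≤ LinearMap.ker (degreePart K G hX n) := by
  refine Submodule.span_le.2 ?_
  rintro _ ⟨p, q, hpq, rfl⟩
  have h := (isShift_rcPath K G hX p).mul (isShift_rcGhostPath K G hX q)
  rw [← map_mul] at h
  exact degreePart_eq_zero K G hX (by omega) h

theorem paFiltration_le_ker {n : ℕ} (hn : 1 ≤ n) :
    G.paFiltration K (n - 1) ≤
      LinearMap.ker (degreePart K G hX n ∘ₗ (paToRc K G X).toLinearMap) := by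
  refine Submodule.span_le.2 ?_
  rintro _ ⟨p, hp, rfl⟩
  refine Eq.trans (congrArg (degreePart K G hX n) (paToRc_path K G X p)) ?_
  exact degreePart_eq_zero K G hX (by omega) (isShift_rcPath K G hX p)

/-- Paths of length n go to basis vectors, and source and code together determine the path. -/
theorem linearIndependent_degreePart (n : ℕ) :
    LinearIndependent K fun p : G.PathOfLength n => degreePart K G hX n (rcPath K G X p.1) := by
  let c : G.PathOfLength n → {x : V × ℕ × ℤ | x.2.2 = (n : ℤ)} := fun p =>
    ⟨(p.1.source, G.pathCode p.1.edges, (n : ℤ)), rfl⟩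
  have hc : Function.Injective c := by
    intro p q h
    have h' := congrArg Subtype.val h
    simp only [c, Prod.mk.injEq] at h'
    refine Subtype.ext (Path.ext h'.1 ?_)
    exact G.pathCode_inj (h'.1 ▸ p.1.isPath) q.1.isPath (p.2.trans q.2.symm) h'.2.1
  convert (Finsupp.basisSingleOne (R := K)).linearIndependent.comp c hc using 1
  funext p
  ext x
  rw [degreePart_apply, rcRep_path_apply, p.2]
  simp only [Function.comp, Finsupp.coe_basisSingleOne]
  classical
  simp [Finsupp.single_apply, c, Subtype.ext_iff]

end Independence

end DirectedGraph

namespace DirectedGraph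

/-! ### Paths span KE. -/

section PathAlgebraSpan

variable (K : Type*) [Field K] {V E : Type*} [Fintype V] (G : DirectedGraph V E)

/-- A subspace containing `1` and stable under left multiplication by the generators of the path
algebra is everything. -/
theorem eq_top_of_mul_mem {B : Type*} [Ring B] [Algebra K B] (f : PathAlgebra K G →ₐ[K] B)
    (hf : Function.Surjective f) (S : Submodule K B) (h1 : 1 ∈ S)
    (hV : ∀ v, ∀ x ∈ S, f (paVertex K G v) * x ∈ S)
    (hE : ∀ e, ∀ x ∈ S, f (paEdge K G e) * x ∈ S) : S = ⊤ := by
  have key : ∀ a : FreeAlgebra K (V ⊕ E), ∀ x ∈ S, f (paMk K G a) * x ∈ S := by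
    intro a
    induction a using FreeAlgebra.induction with
    | grade0 r =>
      intro x hx
      rw [AlgHom.commutes, AlgHom.commutes, ← Algebra.smul_def]
      exact S.smul_mem r hx
    | grade1 x => rcases x with v | e; exacts [hV v, hE e]
    | mul a b ha hb =>
      intro x hx
      rw [map_mul, map_mul, mul_assoc]
      exact ha _ (hb _ hx)
    | add a b ha hb =>
      intro x hx
      rw [map_add, map_add, add_mul]
      exact S.add_mem (ha _ hx) (hb _ hx)
  refine eq_top_iff.2 fun b _ => ?_
  obtain ⟨a, rfl⟩ := hf b
  obtain ⟨a, rfl⟩ := paMk_surjective a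
  simpa using key a 1 h1

theorem mul_mem_span {B : Type*} [Ring B] [Algebra K B] {s : Set B} {a : B}
    (h : ∀ x ∈ s, a * x ∈ Submodule.span K s) (x : B) (hx : x ∈ Submodule.span K s) :
    a * x ∈ Submodule.span K s := by
  have : Submodule.span K s ≤ (Submodule.span K s).comap (LinearMap.mulLeft K a) :=
    Submodule.span_le.2 h
  exact this hx

theorem paVertex_mul_path (p : G.Path) :
    paVertex K G p.source * paPath K G p = paPath K G p := by
  rw [paPath, ← mul_assoc, paVertex_mul_self]

theorem paVertex_mul_path_of_ne {v : V} (p : G.Path) (h : v ≠ p.source) :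
    paVertex K G v * paPath K G p = 0 := by
  rw [paPath, ← mul_assoc, paVertex_mul_of_ne K G h, zero_mul]

theorem paEdge_mul_path (e : E) (p : G.Path) (h : p.source = G.r e) :
    paEdge K G e * paPath K G p = paPath K G ⟨G.s e, e :: p.edges, rfl, h ▸ p.isPath⟩ := by
  simp only [paPath, List.map_cons, List.prod_cons]
  rw [← mul_assoc, ← mul_assoc, paVertex_source_mul, h, paEdge_mul_range]

theorem paEdge_mul_path_of_ne (e : E) (p : G.Path) (h : G.r e ≠ p.source) :
    paEdge K G e * paPath K G p = 0 := by
  rw [← paEdge_mul_range, mul_assoc, paVertex_mul_path_of_ne K G p h, mul_zero]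

/-- A generator times a path is a path or 0, and 1 is the sum of the trivial paths. -/
theorem span_paPath : Submodule.span K (Set.range (paPath K G)) = ⊤ := by
  refine eq_top_of_mul_mem K G (AlgHom.id K _) Function.surjective_id _ ?_ ?_ ?_
  · rw [← sum_paVertex K G]
    exact Submodule.sum_mem _ fun v _ =>
      Submodule.subset_span ⟨⟨v, [], trivial⟩, by simp [paPath]⟩
  · refine fun v => mul_mem_span K ?_
    rintro _ ⟨p, rfl⟩
    by_cases h : v = p.source
    · subst h
      exact Submodule.subset_span ⟨p, (paVertex_mul_path K G p).symm⟩
    · rw [AlgHom.id_apply, paVertex_mul_path_of_ne K G p h]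
      exact Submodule.zero_mem _
  · refine fun e => mul_mem_span K ?_
    rintro _ ⟨p, rfl⟩
    by_cases h : p.source = G.r e
    · exact Submodule.subset_span ⟨_, (paEdge_mul_path K G e p h).symm⟩
    · rw [AlgHom.id_apply, paEdge_mul_path_of_ne K G e p (Ne.symm h)]
      exact Submodule.zero_mem _

theorem finite_pathAlgebra [Finite G.Path] : Module.Finite K (PathAlgebra K G) :=
  ⟨Submodule.fg_def.2 ⟨_, Set.finite_range _, span_paPath K G⟩⟩

end PathAlgebraSpan

/-! ### The elements λμ* span the relative Cohn algebras. -/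

section CohnSpan

variable (K : Type*) [Field K] {V E : Type*} [Fintype V] [Fintype E] (G : DirectedGraph V E)
  (X : Set V)

@[simp]
theorem rcVertex_mul_self (v : V) : rcVertex K G X v * rcVertex K G X v = rcVertex K G X v := by
  rw [rcVertex, ← map_mul, paVertex_mul_self]

theorem rcVertex_mul_of_ne {v w : V} (h : v ≠ w) : rcVertex K G X v * rcVertex K G X w = 0 := by
  rw [rcVertex, rcVertex, ← map_mul, paVertex_mul_of_ne K _ h, map_zero]

@[simp]
theorem rcVertex_source_mul_edge (e : E) :
    rcVertex K G X (G.s e) * rcEdge K G X e = rcEdge K G X e := by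
  rw [rcVertex, rcEdge, ← map_mul]
  exact congrArg _ (paVertex_source_mul K G.extended (Sum.inl e))

@[simp]
theorem rcEdge_mul_range (e : E) : rcEdge K G X e * rcVertex K G X (G.r e) = rcEdge K G X e := by
  rw [rcVertex, rcEdge, ← map_mul]
  exact congrArg _ (paEdge_mul_range K G.extended (Sum.inl e))

@[simp]
theorem rcVertex_range_mul_ghost (e : E) :
    rcVertex K G X (G.r e) * rcGhost K G X e = rcGhost K G X e := by
  rw [rcVertex, rcGhost, ← map_mul]
  exact congrArg _ (paVertex_source_mul K G.extended (Sum.inr e))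

@[simp]
theorem rcGhost_mul_source (e : E) :
    rcGhost K G X e * rcVertex K G X (G.s e) = rcGhost K G X e := by
  rw [rcVertex, rcGhost, ← map_mul]
  exact congrArg _ (paEdge_mul_range K G.extended (Sum.inr e))

theorem rcGhost_mul_edge_self (e : E) :
    rcGhost K G X e * rcEdge K G X e = rcVertex K G X (G.r e) := by
  rw [rcGhost, rcEdge, ← map_mul]
  exact RingQuot.mkAlgHom_rel K (CohnRel.ghost_mul_self (K := K) (G := G) (X := X) e)

theorem rcGhost_mul_edge_of_ne {e f : E} (h : e ≠ f) :
    rcGhost K G X e * rcEdge K G X f = 0 := by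
  rw [rcGhost, rcEdge, ← map_mul, ← map_zero (rcMk K G X)]
  exact RingQuot.mkAlgHom_rel K (CohnRel.ghost_mul_of_ne (K := K) (G := G) (X := X) e f h)

theorem sum_rcVertex : ∑ v, rcVertex K G X v = 1 := by
  simp only [rcVertex, ← map_sum, sum_paVertex, map_one]

theorem rcMk_surjective : Function.Surjective (rcMk K G X) :=
  RingQuot.mkAlgHom_surjective K _

variable {G} in
theorem ghostPath_eq_range_mul {v : V} {l : List E} (h : G.IsPathFrom v l) :
    rcVertex K G X (G.pathRange v l) *
      ((l.reverse.map (rcGhost K G X)).prod * rcVertex K G X v) =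
      (l.reverse.map (rcGhost K G X)).prod * rcVertex K G X v := by
  induction l generalizing v with
  | nil => simp [pathRange]
  | cons e l ih =>
    have h2 := ih h.2
    simp only [List.reverse_cons, List.map_append, List.map_cons, List.map_nil, List.prod_append,
      List.prod_singleton, pathRange]
    rw [← rcVertex_range_mul_ghost K G X e]
    simp only [← mul_assoc] at h2 ⊢
    rw [h2]

theorem rcVertex_mul_path (p : G.Path) :
    rcVertex K G X p.source * rcPath K G X p = rcPath K G X p := by
  rw [rcPath, ← mul_assoc, rcVertex_mul_self]

theorem rcVertex_mul_path_of_ne {v : V} (p : G.Path) (h : v ≠ p.source) :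
    rcVertex K G X v * rcPath K G X p = 0 := by
  rw [rcPath, ← mul_assoc, rcVertex_mul_of_ne K G X h, zero_mul]

theorem rcEdge_mul_path (e : E) (p : G.Path) (h : p.source = G.r e) :
    rcEdge K G X e * rcPath K G X p = rcPath K G X ⟨G.s e, e :: p.edges, rfl, h ▸ p.isPath⟩ := by
  simp only [rcPath, List.map_cons, List.prod_cons]
  rw [← mul_assoc, ← mul_assoc, rcVertex_source_mul_edge, h, rcEdge_mul_range]

theorem rcEdge_mul_path_of_ne (e : E) (p : G.Path) (h : G.r e ≠ p.source) :
    rcEdge K G X e * rcPath K G X p = 0 := by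
  rw [← rcEdge_mul_range, mul_assoc, rcVertex_mul_path_of_ne K G X p h, mul_zero]

/-- If μ ends at s(e), then e*μ* = (μe)*; otherwise two distinct vertices meet in the product. -/
theorem rcGhost_mul_ghostPath (e : E) (q : G.Path) :
    rcGhost K G X e * rcGhostPath K G X q = 0 ∨
      ∃ q', rcGhost K G X e * rcGhostPath K G X q = rcGhostPath K G X q' := by
  by_cases h : G.s e = G.pathRange q.source q.edges
  · refine Or.inr ⟨⟨q.source, q.edges ++ [e], G.isPathFrom_append_singleton q.isPath h.symm⟩, ?_⟩
    simp [rcGhostPath, mul_assoc]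
  · left
    rw [rcGhostPath, ← ghostPath_eq_range_mul K X q.isPath, ← mul_assoc, ← rcGhost_mul_source,
      mul_assoc (rcGhost K G X e), rcVertex_mul_of_ne K G X h, mul_zero, zero_mul]

/-- If λ is nontrivial, (CK1) either strips its first edge or kills the product. If λ is a vertex,
e* reaches μ* and either lengthens it or gives 0. -/
theorem rcGhost_mul_mem (e : E) (p q : G.Path) :
    rcGhost K G X e * (rcPath K G X p * rcGhostPath K G X q) ∈ Submodule.span K
      (Set.range fun x : G.Path × G.Path => rcPath K G X x.1 * rcGhostPath K G X x.2) := by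
  obtain ⟨v, l, hp⟩ := p
  cases l with
  | nil =>
    by_cases h : G.s e = v
    · subst h
      rw [show rcGhost K G X e * (rcPath K G X ⟨G.s e, [], hp⟩ * rcGhostPath K G X q) =
        rcVertex K G X (G.r e) * (rcGhost K G X e * rcGhostPath K G X q) by
          simp [rcPath, ← mul_assoc]]
      obtain h0 | ⟨q', h'⟩ := rcGhost_mul_ghostPath K G X e q
      · rw [h0, mul_zero]
        exact Submodule.zero_mem _
      · rw [h']
        exact Submodule.subset_span ⟨(⟨G.r e, [], trivial⟩, q'), by simp [rcPath]⟩
    · rw [← mul_assoc, ← rcGhost_mul_source, mul_assoc (rcGhost K G X e),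
        rcVertex_mul_path_of_ne K G X _ h, mul_zero, zero_mul]
      exact Submodule.zero_mem _
  | cons f l =>
    obtain ⟨rfl, hl⟩ := hp
    have h2 : rcGhost K G X e * rcPath K G X ⟨G.s f, f :: l, rfl, hl⟩ =
        rcGhost K G X e * rcEdge K G X f * (l.map (rcEdge K G X)).prod := by
      simp only [rcPath, List.map_cons, List.prod_cons]
      rw [← mul_assoc (rcVertex K G X (G.s f)), rcVertex_source_mul_edge, mul_assoc]
    rw [← mul_assoc, h2]
    by_cases h : e = f
    · subst h
      rw [rcGhost_mul_edge_self]
      exact Submodule.subset_span ⟨(⟨G.r e, l, hl⟩, q), rfl⟩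
    · rw [rcGhost_mul_edge_of_ne K G X h, zero_mul, zero_mul]
      exact Submodule.zero_mem _

theorem span_rcPath_mul_ghostPath : Submodule.span K
    (Set.range fun x : G.Path × G.Path => rcPath K G X x.1 * rcGhostPath K G X x.2) = ⊤ := by
  refine eq_top_of_mul_mem K G.extended (rcMk K G X) (rcMk_surjective K G X) _ ?_ ?_ ?_
  · rw [← sum_rcVertex K G X]
    exact Submodule.sum_mem _ fun v _ =>
      Submodule.subset_span ⟨(⟨v, [], trivial⟩, ⟨v, [], trivial⟩), by
        simp [rcPath, rcGhostPath]⟩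
  · refine fun v => mul_mem_span K ?_
    rintro _ ⟨⟨p, q⟩, rfl⟩
    rw [← mul_assoc]
    by_cases h : v = p.source
    · subst h
      exact Submodule.subset_span
        ⟨(p, q), congrArg (· * _) (rcVertex_mul_path K G X p).symm⟩
    · rw [show rcMk K G X (paVertex K G.extended v) * rcPath K G X p = 0 from
        rcVertex_mul_path_of_ne K G X p h, zero_mul]
      exact Submodule.zero_mem _
  · rintro (e | e)
    · refine mul_mem_span K ?_
      rintro _ ⟨⟨p, q⟩, rfl⟩
      rw [← mul_assoc]
      by_cases h : p.source = G.r e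
      · exact Submodule.subset_span
          ⟨(⟨G.s e, e :: p.edges, rfl, h ▸ p.isPath⟩, q), congrArg (· * _) (rcEdge_mul_path K G X e p h).symm⟩
      · rw [show rcMk K G X (paEdge K G.extended (Sum.inl e)) * rcPath K G X p = 0 from
          rcEdge_mul_path_of_ne K G X e p (Ne.symm h), zero_mul]
        exact Submodule.zero_mem _
    · refine mul_mem_span K ?_
      rintro _ ⟨⟨p, q⟩, rfl⟩
      exact rcGhost_mul_mem K G X e p q

theorem finite_relCohnAlgebra [Finite G.Path] : Module.Finite K (RelCohnAlgebra K G X) :=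
  ⟨Submodule.fg_def.2 ⟨_, Set.finite_range _, span_rcPath_mul_ghostPath K G X⟩⟩

theorem rcPath_mem_rcFiltration (p : G.Path) : rcPath K G X p ∈ G.rcFiltration K X p.length := by
  -- Each vertex is the ghost of a trivial path, so writing 1 as their sum avoids identifying the
  -- range of p.
  rw [← mul_one (rcPath K G X p), ← sum_rcVertex K G X, Finset.mul_sum]
  exact Submodule.sum_mem _ fun v _ =>
    Submodule.subset_span ⟨p, ⟨v, [], trivial⟩, le_rfl, by simp [rcGhostPath]⟩

end CohnSpan

/-! ### Comparison of the entropies. -/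

section Entropy

variable (K : Type*) [Field K] {V E : Type*} [Fintype V] [Fintype E] (G : DirectedGraph V E)
  {X : Set V}

theorem numPaths_le_gradedDim_rcFiltration (hX : ∀ v ∈ X, G.IsRegular v) {n : ℕ} (hn : 1 ≤ n) :
    (G.numPaths n : ℕ∞) ≤ gradedDim K (G.rcFiltration K X) n :=
  card_le_gradedDim _ n (fun p : G.PathOfLength n => rcPath K G X p.1)
    (fun p => rcFiltration_mono K G X p.2.le (rcPath_mem_rcFiltration K G X p.1)) (degreePart K G hX n)
    (rcFiltration_le_ker K G hX hn) (linearIndependent_degreePart K G hX n)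

theorem gradedDim_paFiltration {n : ℕ} (hn : 1 ≤ n) :
    gradedDim K (G.paFiltration K) n = G.numPaths n := by
  refine (gradedDim_paFiltration_le K G n).antisymm ?_
  -- Independence in KE is detected after mapping to C_K(E), the case X = ∅.
  have hX : ∀ v ∈ (∅ : Set V), G.IsRegular v := by simp
  refine card_le_gradedDim _ n (fun p : G.PathOfLength n => paPath K G p.1)
    (fun p => Submodule.subset_span ⟨p.1, p.2.le, rfl⟩) _ (paFiltration_le_ker K G hX hn) ?_
  have h : ∀ p : G.Path, degreePart K G hX n (paToRc K G ∅ (paPath K G p)) =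
      degreePart K G hX n (rcPath K G ∅ p) :=
    fun p => congrArg (degreePart K G hX n) (paToRc_path K G ∅ p)
  simpa only [LinearMap.comp_apply, AlgHom.toLinearMap_apply, h] using
    linearIndependent_degreePart K G hX n

/-- The entropy of a relative Cohn path algebra is that of the path algebra. -/
theorem algEntropy_rcFiltration (hX : ∀ v ∈ X, G.IsRegular v) :
    algEntropy K (G.rcFiltration K X) = algEntropy K (G.paFiltration K) := by
  by_cases h0 : ∃ n, G.numPaths n = 0
  · obtain ⟨n, hn⟩ := h0
    have := finite_path_of_numPaths_eq_zero hn
    rw [algEntropy, algEntropy, if_pos (finite_relCohnAlgebra K G X),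
      if_pos (finite_pathAlgebra K G)]
  have hp : ∀ n, 1 ≤ G.numPaths n := fun n => Nat.one_le_iff_ne_zero.2 fun h => h0 ⟨n, h⟩
  -- The upper bound is finite, so the graded dimensions are natural numbers and the growth lemma
  -- applies.
  have hd : ∀ n, ∃ d : ℕ, gradedDim K (G.rcFiltration K X) n = d ∧
      d ≤ ∑ k : Fin (n + 1), G.numPaths k * G.numPaths (n - k) := by
    intro n
    have h := gradedDim_rcFiltration_le K G X n
    obtain ⟨d, hd⟩ := ENat.ne_top_iff_exists.1 (ne_top_of_le_ne_top (ENat.natCast_ne_top _) h)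
    rw [← hd] at h
    exact ⟨d, hd.symm, by exact_mod_cast h⟩
  choose d hd hdle using hd
  have hpd : ∀ n, 1 ≤ n → G.numPaths n ≤ d n := fun n hn => by
    have := numPaths_le_gradedDim_rcFiltration K G hX hn
    rw [hd n] at this
    exact_mod_cast this
  have hrc : ¬ Module.Finite K (RelCohnAlgebra K G X) :=
    not_finite_of_gradedDim_pos _ (rcFiltration_mono K G X) fun n hn => by
      rw [hd n]
      exact_mod_cast Nat.one_le_iff_ne_zero.1 ((hp n).trans (hpd n hn))
  have hpa : ¬ Module.Finite K (PathAlgebra K G) :=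
    not_finite_of_gradedDim_pos _ (paFiltration_mono K G) fun n hn => by
      rw [gradedDim_paFiltration K G hn]
      exact_mod_cast (Nat.one_le_iff_ne_zero.1 (hp n))
  rw [algEntropy, algEntropy, if_neg hrc, if_neg hpa]
  have e1 : Filter.limsup (fun n : ℕ => ENNReal.log
      (gradedDim K (G.paFiltration K) n : ENNReal) / (n : EReal)) Filter.atTop =
      Filter.limsup (fun n : ℕ => ENNReal.log (G.numPaths n : ENNReal) / (n : EReal))
        Filter.atTop := by
    refine Filter.limsup_congr ?_
    filter_upwards [Filter.eventually_ge_atTop 1] with n hn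
    rw [gradedDim_paFiltration K G hn, ENat.toENNReal_coe]
  rw [e1]
  simp only [hd, ENat.toENNReal_coe]
  refine le_antisymm (limsup_log_le_of_le_convolution hp
    (fun n hn => (hp n).trans (hpd n hn)) fun n _ => hdle n) ?_
  refine Filter.limsup_le_limsup ?_
  filter_upwards [Filter.eventually_ge_atTop 1] with n hn
  exact EReal.div_le_div_right_of_nonneg (by positivity)
    (ENNReal.log_monotone (by exact_mod_cast hpd n hn))

end Entropy

end DirectedGraph

theorem theorem3p4 (K : Type*) [Field K] {V E : Type*} [Fintype V] [Fintype E]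
    (G : DirectedGraph V E) :
    algEntropy K (G.cohnFiltration K) ≤ algEntropy K (G.paFiltration K) ∧
      algEntropy K (G.paFiltration K) = algEntropy K (G.leavittFiltration K) ∧
      algEntropy K (G.leavittFiltration K) = algEntropy K (G.cohnFiltration K) := by
  have hC := G.algEntropy_rcFiltration K (X := ∅) (by simp)
  have hL := G.algEntropy_rcFiltration K (X := {v | G.IsRegular v}) fun _ h => h
  exact ⟨hC.le, hL.symm, hL.trans hC.symm⟩
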